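/- **Regularization theorem.** Conventions. A group $\Gamma$ has *Property FW* if for every $\Gamma$-set $E$ and every $A\subseteq E$ such that $A\triangle gA$ is finite for all $g\in\Gamma$, there is a $\Gamma$-invariant $B\subseteq E$ with $A\triangle B$ finite. An *affinely-modeled* (resp. *projectively-modeled*) 1-manifold is a topological space, not assumed Hausdorff or connected, with an atlas of homeomorphisms from open subsets onto open subsets of $\mathbf R$ (resp. of $\mathbf P^1=\mathbf R\cup\{\infty\}$), whose changes of charts are locally of the form $x\mapsto ax+b$ with $a\neq 0$ (resp. $x\mapsto\frac{ax+b}{cx+d}$ with $ad-bc\ne 0$). It is *finitely-charted* if it is covered by the domains of finitely many charts, each with connected domain and with values in a bounded interval of $\mathbf R$ (charts being taken in the maximal compatible atlas). A *piecewise affine* (resp. *piecewise homographic*) transformation $X\dashrightarrow Y$ is a homeomorphism between cofinite (open) subsets of $X$ and of $Y$ which in charts is locally affine (resp. homographic), two of them being identified when they coincide on a cofinite subset. Those with $Y=X$ form a group under composition, denoted $\mathrm{PC}_{\mathbf{Aff}}(X)$ (resp. $\mathrm{PC}_{\mathbf{Proj}}(X)$). An affine (resp. homographic) automorphism of $Y$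 is a homeomorphism $Y\to Y$ which in charts is locally affine (resp. homographic). **Theorem.** Let $\Gamma$ be a group with Property FW, let $X$ be a Hausdorff finitely-charted affinely-modeled (resp. projectively-modeled) 1-manifold, and let $\rho:\Gamma\to\mathrm{PC}_{\mathbf{Aff}}(X)$ (resp. $\rho:\Gamma\to\mathrm{PC}_{\mathbf{Proj}}(X)$) be a homomorphism. Then there exist a Hausdorff finitely-charted affinely-modeled (resp. projectively-modeled) 1-manifold $Y$, a piecewise affine (resp. piecewise homographic) transformation $\varphi:X\dashrightarrow Y$, and a homomorphism $\beta$ from $\Gamma$ to the group of affine (resp. homographic) automorphisms of $Y$, such that for every $g\in\Gamma$ the piecewise transformation $\varphi\circ\rho(g)\circ\varphi^{-1}$ of $Y$ is the class of the automorphism $\beta(g)$. -/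

import Mathlib

open Set Topology Manifold
open scoped Pointwise symmDiff

universe u

/-! ### Property FW -/

/-- A group `Γ` has Property FW if in every `Γ`-set `E`, every subset `A` such that `A ∆ gA` is
finite for all `g` coincides with a `Γ`-invariant subset modulo a finite set. -/
def PropertyFW (Γ : Type u) [Group Γ] : Prop :=
  ∀ (E : Type u) [MulAction Γ E] (A : Set E), (∀ g : Γ, (A ∆ (g • A)).Finite) →
    ∃ B : Set E, (∀ g : Γ, g • B = B) ∧ (A ∆ B).Finite

/-! ### The affine and the projective geometric structure in dimension 1 -/

/-- The structure groupoid of those homeomorphisms between open subsets of `H` that coincide,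
near every point of their domain, with an element of a given group `T` of permutations of `H`. -/
def locallyInGroupoid {H : Type*} [TopologicalSpace H] (T : Subgroup (Equiv.Perm H)) :
    StructureGroupoid H where
  members := {e | ∀ x ∈ e.source, ∃ t ∈ T, ∀ᶠ y in 𝓝 x, e y = t y}
  trans' := by
    intro e e' he he' x hx
    rw [OpenPartialHomeomorph.trans_source] at hx
    obtain ⟨t, ht, h⟩ := he x hx.1
    obtain ⟨t', ht', h'⟩ := he' (e x) hx.2
    refine ⟨t' * t, T.mul_mem ht' ht, ?_⟩
    filter_upwards [h, (e.continuousAt hx.1).eventually h'] with y hy hy'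
    rw [OpenPartialHomeomorph.coe_trans, Function.comp_apply, hy', hy, Equiv.Perm.mul_apply]
  symm' := by
    intro e he x hx
    obtain ⟨t, ht, h⟩ := he (e.symm x) (e.map_target hx)
    refine ⟨t⁻¹, T.inv_mem ht, ?_⟩
    filter_upwards [(e.symm.continuousAt hx).eventually h, e.open_target.mem_nhds hx] with y hy hy'
    rw [e.right_inv hy'] at hy
    rw [Equiv.Perm.eq_inv_iff_eq]
    exact hy.symm
  id_mem' := fun x _ => ⟨1, T.one_mem, by simp⟩
  locality' := by
    intro e h x hx
    obtain ⟨s, hs, hxs, hres⟩ := h x hx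
    obtain ⟨t, ht, h⟩ := hres x (by simp [hx, hs.interior_eq, hxs])
    exact ⟨t, ht, by simpa using h⟩
  mem_of_eqOnSource' := by
    intro e e' he hee' x hx
    obtain ⟨t, ht, h⟩ := he x (hee'.1 ▸ hx)
    refine ⟨t, ht, ?_⟩
    filter_upwards [h, e'.open_source.mem_nhds hx] with y hy hy'
    rw [hee'.2 hy', hy]

/-- The group of affine permutations `x ↦ a x + b`, `a ≠ 0`, of the real line. -/
def affineGroup : Subgroup (Equiv.Perm ℝ) where
  carrier := {σ | ∃ a b : ℝ, a ≠ 0 ∧ ∀ x, σ x = a * x + b}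
  one_mem' := ⟨1, 0, by simp⟩
  mul_mem' := by
    rintro σ τ ⟨a, b, ha, h⟩ ⟨c, d, hc, h'⟩
    exact ⟨a * c, a * d + b, mul_ne_zero ha hc, fun x => by simp [h, h']; ring⟩
  inv_mem' := by
    rintro σ ⟨a, b, ha, h⟩
    refine ⟨a⁻¹, -(a⁻¹ * b), inv_ne_zero ha, fun x => ?_⟩
    rw [Equiv.Perm.inv_eq_iff_eq, h]
    field_simp
    ring

/-- The group of homographies `x ↦ (a x + b) / (c x + d)`, `a d - b c ≠ 0`, of the real projective
line, the latter being the one-point compactification of the real line. -/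
noncomputable def homographicGroup : Subgroup (Equiv.Perm (OnePoint ℝ)) :=
  (MulAction.toPermHom (GL (Fin 2) ℝ) (OnePoint ℝ)).range

/-- An affinely-modeled 1-manifold is an `X` with `[ChartedSpace ℝ X] [HasGroupoid X Aff]`. -/
def Aff : StructureGroupoid ℝ := locallyInGroupoid affineGroup

/-- A projectively-modeled 1-manifold is an `X` with
`[ChartedSpace (OnePoint ℝ) X] [HasGroupoid X Proj]`. -/
noncomputable def Proj : StructureGroupoid (OnePoint ℝ) := locallyInGroupoid homographicGroup

/-- `X` has a finite covering by bounded charts: a bounded chart is a chart (of the maximal atlas)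
with connected domain and with values in a bounded interval of `ℝ`. Here `ι : ℝ → H` is the
inclusion of the real line into the model space. -/
def FinitelyCharted {H : Type*} [TopologicalSpace H] (G : StructureGroupoid H) (ι : ℝ → H)
    (X : Type*) [TopologicalSpace X] [ChartedSpace H X] : Prop :=
  ∃ S : Set (OpenPartialHomeomorph X H), S.Finite ∧ S ⊆ G.maximalAtlas X ∧
    (⋃ e ∈ S, e.source) = univ ∧
    ∀ e ∈ S, IsPreconnected e.source ∧ ∃ a b : ℝ, e.target ⊆ ι '' Ioo a b

/-! ### Piecewise transformations -/

section Piecewise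

variable {H : Type*} [TopologicalSpace H] (G : StructureGroupoid H)
  (X Y Z : Type*) [TopologicalSpace X] [ChartedSpace H X] [TopologicalSpace Y] [ChartedSpace H Y]
  [TopologicalSpace Z] [ChartedSpace H Z]

/-- An isomorphism between cofinite (open) subsets of `X` and `Y` which in the charts belongs to the
groupoid `G`. -/
structure CofiniteIso where
  map : OpenPartialHomeomorph X Y
  finite_source : (map.source)ᶜ.Finite
  finite_target : (map.target)ᶜ.Finite
  mem_groupoid : ∀ c ∈ atlas H X, ∀ c' ∈ atlas H Y, c.symm ≫ₕ map ≫ₕ c' ∈ G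

variable {G X Y Z}

namespace CofiniteIso

def symm (f : CofiniteIso G X Y) : CofiniteIso G Y X where
  map := f.map.symm
  finite_source := f.finite_target
  finite_target := f.finite_source
  mem_groupoid := by
    intro c hc c' hc'
    have := G.symm (f.mem_groupoid c' hc' c hc)
    rwa [OpenPartialHomeomorph.trans_symm_eq_symm_trans_symm,
      OpenPartialHomeomorph.trans_symm_eq_symm_trans_symm, OpenPartialHomeomorph.symm_symm,
      OpenPartialHomeomorph.trans_assoc] at this

theorem finite_compl_trans_source (f : OpenPartialHomeomorph X Y) (g : OpenPartialHomeomorph Y Z)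
    (hf : (f.source)ᶜ.Finite) (hg : (g.source)ᶜ.Finite) : ((f ≫ₕ g).source)ᶜ.Finite := by
  refine (hf.union (hg.image f.symm)).subset fun x hx => ?_
  by_cases h : x ∈ f.source
  · exact Or.inr ⟨f x, fun h' => hx (by simp [h, h']), f.left_inv h⟩
  · exact Or.inl h

/-- Composition, the domain of definition being the natural one. -/
def trans (f : CofiniteIso G X Y) (g : CofiniteIso G Y Z) : CofiniteIso G X Z where
  map := f.map ≫ₕ g.map
  finite_source := finite_compl_trans_source _ _ f.finite_source g.finite_source
  finite_target :=
    finite_compl_trans_source g.map.symm f.map.symm g.finite_target f.finite_target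
  mem_groupoid := by
    intro c hc c' hc'
    refine G.locality fun x hx ↦ ?_
    let k := chartAt (H := H) ((c.symm ≫ₕ f.map) x)
    have hk : k ∈ atlas H Y := chart_mem_atlas (H := H) _
    let s := (c.symm ≫ₕ f.map).source ∩ c.symm ≫ₕ f.map ⁻¹' k.source
    have open_s : IsOpen s :=
      (c.symm ≫ₕ f.map).continuousOn.isOpen_inter_preimage
        (OpenPartialHomeomorph.open_source _) k.open_source
    have hxs : x ∈ s := by
      refine ⟨?_, mem_chart_source (H := H) _⟩
      simp only [OpenPartialHomeomorph.trans_source, mem_inter_iff, mem_preimage] at hx ⊢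
      exact ⟨hx.1, hx.2.1.1⟩
    refine ⟨s, open_s, hxs, G.mem_of_eqOnSource
      (G.trans (f.mem_groupoid c hc k hk) (g.mem_groupoid k hk c' hc')) ?_⟩
    constructor
    · rw [OpenPartialHomeomorph.restr_source' _ _ open_s]
      ext y
      simp only [s, OpenPartialHomeomorph.trans_source, OpenPartialHomeomorph.symm_source,
        mem_inter_iff, mem_preimage, OpenPartialHomeomorph.coe_trans, Function.comp_apply]
      constructor
      · rintro ⟨⟨h1, ⟨h2, h3⟩, h4⟩, -, h5⟩
        exact ⟨⟨h1, h2, h5⟩, k.map_source h5, by rwa [k.left_inv h5], by rwa [k.left_inv h5]⟩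
      · rintro ⟨⟨h1, h2, h5⟩, -, h3, h4⟩
        rw [k.left_inv h5] at h3 h4
        exact ⟨⟨h1, ⟨h2, h3⟩, h4⟩, ⟨h1, h2⟩, h5⟩
    · intro y hy
      rw [OpenPartialHomeomorph.restr_source' _ _ open_s] at hy
      have h5 : f.map (c.symm y) ∈ k.source := hy.2.2
      simp [k.left_inv h5]

/-- A global isomorphism, seen as an isomorphism between cofinite subsets. -/
def ofStructomorph (f : Structomorph G X Y) : CofiniteIso G X Y where
  map := f.toHomeomorph.toOpenPartialHomeomorph
  finite_source := by simp
  finite_target := by simp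
  mem_groupoid := fun c hc c' hc' => f.mem_groupoid c c' hc hc'

/-- Two isomorphisms between cofinite subsets are identified when they coincide on a cofinite
subset. -/
def Agree (f g : CofiniteIso G X Y) : Prop :=
  {x | x ∈ f.map.source ∧ x ∈ g.map.source ∧ f.map x = g.map x}ᶜ.Finite

theorem Agree.symm_map {f g : CofiniteIso G X Y} (h : Agree f g) : Agree f.symm g.symm := by
  refine ((f.finite_target.union g.finite_target).union (h.image f.map)).subset fun y hy => ?_
  by_cases h1 : y ∈ f.map.target
  · by_cases h2 : y ∈ g.map.target
    · refine Or.inr ⟨f.map.symm y, fun hx => hy ⟨h1, h2, ?_⟩, f.map.right_inv h1⟩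
      have h3 := hx.2.2
      rw [f.map.right_inv h1] at h3
      change f.map.symm y = g.map.symm y
      rw [h3, g.map.left_inv hx.2.1, ← h3]
    · exact Or.inl (Or.inr h2)
  · exact Or.inl (Or.inl h1)

theorem Agree.trans_map {f f' : CofiniteIso G X Y} {g g' : CofiniteIso G Y Z} (h : Agree f f')
    (h' : Agree g g') : Agree (f.trans g) (f'.trans g') := by
  refine (h.union (h'.image f.map.symm)).subset fun x hx => ?_
  by_cases h1 : x ∈ f.map.source ∧ x ∈ f'.map.source ∧ f.map x = f'.map x
  · refine Or.inr ⟨f.map x, fun h2 => hx ?_, f.map.left_inv h1.1⟩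
    have h3 := h2.2.1
    rw [h1.2.2] at h3
    refine ⟨⟨h1.1, h2.1⟩, ⟨h1.2.1, h3⟩, ?_⟩
    change g.map (f.map x) = g'.map (f'.map x)
    rw [h2.2.2, h1.2.2]
  · exact Or.inl h1

/-- Agreement of explicit maps off a finite set. -/
theorem agree_of_eqOn {f g : CofiniteIso G X Y}
    (h : ∀ x ∈ f.map.source, x ∈ g.map.source → f.map x = g.map x) : Agree f g := by
  refine (f.finite_source.union g.finite_source).subset fun x hx => ?_
  by_contra hc
  simp only [mem_union, mem_compl_iff, not_or, not_not] at hc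
  exact hx ⟨hc.1, hc.2, h x hc.1 hc.2⟩

variable (G X Y) in
instance setoid : Setoid (CofiniteIso G X Y) where
  r := Agree
  iseqv :=
    { refl := fun _ => agree_of_eqOn fun _ _ _ => rfl
      symm := fun {f g} h => h.subset fun x hx hx' => hx ⟨hx'.2.1, hx'.1, hx'.2.2.symm⟩
      trans := fun {f g k} h h' => (h.union h').subset fun x hx => by
        by_contra hc
        simp only [mem_union, mem_compl_iff, mem_ofPred_eq, not_or, not_not] at hc
        exact hx ⟨hc.1.1, hc.2.2.1, hc.1.2.2.trans hc.2.2.2⟩ }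

end CofiniteIso

variable (G X Y) in
/-- Piecewise transformations from `X` to `Y`. -/
def PCTrans : Type _ := Quotient (CofiniteIso.setoid G X Y)

variable (G X) in
/-- The piecewise self-transformations of `X`. -/
abbrev PC : Type _ := PCTrans G X X

namespace PCTrans

/-- The inverse piecewise transformation. -/
def symm (f : PCTrans G X Y) : PCTrans G Y X :=
  Quotient.map CofiniteIso.symm (fun _ _ h => CofiniteIso.Agree.symm_map h) f

/-- The composition "first `f`, then `g`" of piecewise transformations. -/
def trans (f : PCTrans G X Y) (g : PCTrans G Y Z) : PCTrans G X Z :=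
  Quotient.map₂ CofiniteIso.trans (fun _ _ h _ _ h' => CofiniteIso.Agree.trans_map h h') f g

/-- The piecewise transformation defined by a global isomorphism. -/
def ofStructomorph (f : Structomorph G X Y) : PCTrans G X Y :=
  Quotient.mk _ (CofiniteIso.ofStructomorph f)

theorem trans_assoc {W : Type*} [TopologicalSpace W] [ChartedSpace H W] (f : PCTrans G X Y)
    (g : PCTrans G Y Z) (h : PCTrans G Z W) : (f.trans g).trans h = f.trans (g.trans h) := by
  induction f, g using Quotient.inductionOn₂
  induction h using Quotient.inductionOn
  exact Quotient.sound (CofiniteIso.agree_of_eqOn fun _ _ _ => rfl)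

theorem refl_trans [HasGroupoid X G] (f : PCTrans G X Y) :
    (ofStructomorph (Structomorph.refl X)).trans f = f := by
  induction f using Quotient.inductionOn
  exact Quotient.sound (CofiniteIso.agree_of_eqOn fun _ _ _ => rfl)

theorem trans_refl [HasGroupoid Y G] (f : PCTrans G X Y) :
    f.trans (ofStructomorph (Structomorph.refl Y)) = f := by
  induction f using Quotient.inductionOn
  exact Quotient.sound (CofiniteIso.agree_of_eqOn fun _ _ _ => rfl)

theorem trans_symm [HasGroupoid X G] (f : PCTrans G X Y) :
    f.trans f.symm = ofStructomorph (Structomorph.refl X) := by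
  induction f using Quotient.inductionOn with
  | h f => exact Quotient.sound (CofiniteIso.agree_of_eqOn fun _ h _ => f.map.left_inv h.1)

theorem symm_trans [HasGroupoid Y G] (f : PCTrans G X Y) :
    f.symm.trans f = ofStructomorph (Structomorph.refl Y) := by
  induction f using Quotient.inductionOn with
  | h f => exact Quotient.sound (CofiniteIso.agree_of_eqOn fun _ h _ => f.map.right_inv h.1)

/-- The group structure on `PC G X`: the product `f * g` is `f ∘ g`. -/
instance instGroup [HasGroupoid X G] : Group (PC G X) where
  mul f g := g.trans f
  one := ofStructomorph (Structomorph.refl X)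
  inv f := f.symm
  mul_assoc f g h := (trans_assoc h g f).symm
  one_mul f := trans_refl f
  mul_one f := refl_trans f
  inv_mul_cancel f := trans_symm f

/-- The map `f ↦ φ ∘ f ∘ φ⁻¹` induced by a piecewise transformation `φ` from `X` to `Y`. -/
def conj [HasGroupoid X G] [HasGroupoid Y G] (φ : PCTrans G X Y) : PC G X →* PC G Y :=
  MonoidHom.mk' (fun f => (φ.symm.trans f).trans φ) (fun f g => by
    change (φ.symm.trans (g.trans f)).trans φ
      = ((φ.symm.trans g).trans φ).trans ((φ.symm.trans f).trans φ)
    simp only [trans_assoc]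
    rw [← trans_assoc φ φ.symm, trans_symm, refl_trans])

end PCTrans

/-- The group of automorphisms of `X`: the product `f * g` is `f ∘ g`. -/
instance Structomorph.instGroupSelf [HasGroupoid X G] : Group (Structomorph G X X) where
  mul f g := g.trans f
  one := Structomorph.refl X
  inv f := f.symm
  mul_assoc _ _ _ := rfl
  one_mul _ := rfl
  mul_one _ := rfl
  inv_mul_cancel f := by
    have h : (f.trans f.symm).toHomeomorph = (Structomorph.refl (G := G) X).toHomeomorph :=
      Homeomorph.ext fun x => f.toHomeomorph.symm_apply_apply x
    change f.trans f.symm = Structomorph.refl X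
    cases h1 : f.trans f.symm
    cases h2 : Structomorph.refl (G := G) X
    simp only [h1, h2] at h
    subst h
    rfl

/-- Automorphisms of `X`, seen as piecewise self-transformations of `X`. -/
def autToPC [HasGroupoid X G] : Structomorph G X X →* PC G X :=
  MonoidHom.mk' PCTrans.ofStructomorph (fun _ _ =>
    Quotient.sound (CofiniteIso.agree_of_eqOn fun _ _ _ => rfl))

end Piecewise

/-! Two representatives of `ρ g` agree wherever both are defined, since `X` is Hausdorff without
isolated points. So `ρ` is a partial action of `Γ` on `X`, and it embeds in an honest action on its
globalization: copies `gX` of `X`, glued along the partial action. This space is modeled on the same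
geometry, but in general it is neither Hausdorff nor finitely charted.

Each `g` is defined on a cofinite subset, so `X` is commensurated in the globalization
(`finite_range_symmDiff_smul`), and Property FW yields an invariant `B` differing from `X` by
finitely many points. By invariance `B` has the same cofinite trace on every `gX`, hence is open.

Dimension one makes `B` almost Hausdorff. A point of `X` not separated from `gp`, with `gp` outside
`X`, is a cluster point at `p` of a representative of `ρ g`. An injective continuous map to a
Hausdorff 1-manifold has at most one cluster point on each side of `p`
(`finite_mapClusterPt_nhdsNE`). Hence the nonseparated points of `B` form a finite invariant set,
and `Y` is `B` without them.

Finitely many translates of `X ∩ Y` cover `Y`, each a copy of `X` minus a finite set. Removing a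
point from a bounded chart leaves two bounded charts, so `Y` is finitely charted. The identity on `X
∩ Y` conjugates `ρ` to the action on `Y`. -/

/-! ### One-dimensional topology -/

/-- In a Hausdorff space, a preconnected set that avoids the two endpoints of a compact interval
contained in a chart and meets the interior of this interval is contained in this interior. -/
theorem IsPreconnected.subset_chart_Ioo {X : Type*} [TopologicalSpace X] [T2Space X]
    (d : OpenPartialHomeomorph X ℝ) {a b : ℝ} (hd : Icc a b ⊆ d.target) {S : Set X}
    (hS : IsPreconnected S) (ha : d.symm a ∉ S) (hb : d.symm b ∉ S)
    (h : (S ∩ d.symm '' Ioo a b).Nonempty) : S ⊆ d.symm '' Ioo a b := by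
  -- The closed arc is compact, hence closed. Once the endpoints are missed, the open arc and the
  -- complement of the closed arc are disjoint open sets covering `S`.
  have hK : IsClosed (d.symm '' Icc a b) :=
    (isCompact_Icc.image_of_continuousOn (d.continuousOn_symm.mono hd)).isClosed
  have hU : IsOpen (d.symm '' Ioo a b) :=
    d.symm.isOpen_image_of_subset_source isOpen_Ioo (Ioo_subset_Icc_self.trans hd)
  refine hS.subset_left_of_subset_union hU hK.isOpen_compl ?_ ?_ h
  · exact disjoint_compl_right.mono_left (image_mono Ioo_subset_Icc_self)
  · intro x hx
    by_cases hxK : x ∈ d.symm '' Icc a b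
    · obtain ⟨t, ht, rfl⟩ := hxK
      refine Or.inl ⟨t, ⟨lt_of_le_of_ne ht.1 ?_, lt_of_le_of_ne ht.2 ?_⟩, rfl⟩
      · rintro rfl; exact ha hx
      · rintro rfl; exact hb hx
    · exact Or.inr hxK

/-- In a Hausdorff space that is locally homeomorphic to the real line, every cluster point of an
injective continuous map along a filter having a basis of preconnected sets, and finer than the
cofinite filter, is a limit. -/
theorem MapClusterPt.tendsto_of_injOn {X W : Type*} [TopologicalSpace X] [T2Space X]
    [TopologicalSpace W] (hX : ∀ x : X, ∃ d : OpenPartialHomeomorph X ℝ, x ∈ d.source)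
    {l : Filter W} (hl : l ≤ Filter.cofinite)
    (hl' : ∀ s ∈ l, ∃ t ∈ l, t ⊆ s ∧ IsPreconnected t)
    {f : W → X} {s : Set W} (hs : s ∈ l) (hf : ContinuousOn f s) (hinj : InjOn f s) {x : X}
    (hx : MapClusterPt x l f) : Filter.Tendsto f l (𝓝 x) := by
  obtain ⟨d, hxd⟩ := hX x
  intro V hV
  have h1 : d.target ∩ d.symm ⁻¹' V ∈ 𝓝 (d x) := by
    refine Filter.inter_mem (d.open_target.mem_nhds (d.map_source hxd)) ?_
    exact (d.symm.continuousAt (d.map_source hxd)) (by simpa [d.left_inv hxd] using hV)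
  obtain ⟨δ, hδ, hball⟩ := Metric.nhds_basis_closedBall.mem_iff.1 h1
  rw [Real.closedBall_eq_Icc] at hball
  set a := d x - δ
  set b := d x + δ
  -- By injectivity each endpoint of the arc around `x` is hit at most once, so a preconnected
  -- member `t` of `l` avoids both. Its image meets the arc by clustering, hence stays inside.
  have hfin : ({w ∈ s | f w = d.symm a} ∪ {w ∈ s | f w = d.symm b}).Finite := by
    refine Set.Finite.union (Set.Subsingleton.finite ?_) (Set.Subsingleton.finite ?_)
    · exact fun u hu v hv => hinj hu.1 hv.1 (hu.2.trans hv.2.symm)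
    · exact fun u hu v hv => hinj hu.1 hv.1 (hu.2.trans hv.2.symm)
  obtain ⟨t, htl, hts, htc⟩ := hl' _ (Filter.inter_mem hs (hl hfin.compl_mem_cofinite))
  have hIoo : d.symm '' Ioo a b ∈ 𝓝 x := by
    have : d.symm '' Ioo a b ∈ 𝓝 (d.symm (d x)) :=
      d.symm.image_mem_nhds (d.map_source hxd) (Ioo_mem_nhds (by simp [a, hδ]) (by simp [b, hδ]))
    rwa [d.left_inv hxd] at this
  have hne : (f '' t ∩ d.symm '' Ioo a b).Nonempty := by
    obtain ⟨w, hw, hw'⟩ := ((MapClusterPt.frequently hx hIoo).and_eventually htl).exists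
    exact ⟨f w, ⟨w, hw', rfl⟩, hw⟩
  have hsub := (htc.image f (hf.mono fun w hw => (hts hw).1)).subset_chart_Ioo d
    (fun z hz => (hball hz).1) ?_ ?_ hne
  · rw [Filter.mem_map]
    filter_upwards [htl] with w hw
    obtain ⟨z, hz, hzw⟩ := hsub ⟨w, hw, rfl⟩
    rw [mem_preimage, ← hzw]
    exact (hball (Ioo_subset_Icc_self hz)).2
  · rintro ⟨w, hw, hw'⟩
    exact (hts hw).2 (Or.inl ⟨(hts hw).1, hw'⟩)
  · rintro ⟨w, hw, hw'⟩
    exact (hts hw).2 (Or.inr ⟨(hts hw).1, hw'⟩)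

/-- In a Hausdorff space locally homeomorphic to the real line, an injective continuous map defined
on a punctured neighborhood of a point has finitely many cluster points at this point. -/
theorem finite_mapClusterPt_nhdsNE {X : Type*} [TopologicalSpace X] [T2Space X]
    (hX : ∀ x : X, ∃ d : OpenPartialHomeomorph X ℝ, x ∈ d.source)
    {f : X → X} {p : X} {s : Set X} (hs : s ∈ 𝓝[≠] p) (hf : ContinuousOn f s) (hinj : InjOn f s) :
    {x | MapClusterPt x (𝓝[≠] p) f}.Finite := by
  obtain ⟨d, hpd⟩ := hX p
  -- To be applied to the left and right filters at `d p`: they have bases of intervals, which the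
  -- punctured filter itself does not.
  have key : ∀ l : Filter ℝ, l ≤ 𝓝[≠] (d p) →
      (∀ s ∈ l, ∃ t ∈ l, t ⊆ s ∧ IsPreconnected t) →
      {x | MapClusterPt x l (f ∘ d.symm)}.Subsingleton := by
    intro l hl hl' x hx y hy
    have hmem : d.target ∩ d.symm ⁻¹' s ∈ l := by
      refine hl ?_
      obtain ⟨U, hU, hUs⟩ := mem_nhdsWithin_iff_exists_mem_nhds_inter.1 hs
      have hUt : d.target ∩ d.symm ⁻¹' U ∈ 𝓝 (d p) := by
        refine Filter.inter_mem (d.open_target.mem_nhds (d.map_source hpd)) ?_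
        exact (d.symm.continuousAt (d.map_source hpd)) (by simpa [d.left_inv hpd] using hU)
      filter_upwards [mem_nhdsWithin_of_mem_nhds hUt, self_mem_nhdsWithin] with z hz hz'
      refine ⟨hz.1, hUs ⟨hz.2, fun h => hz' ?_⟩⟩
      rw [mem_singleton_iff] at h ⊢
      rw [← h, d.right_inv hz.1]
    have hc : ContinuousOn (f ∘ d.symm) (d.target ∩ d.symm ⁻¹' s) :=
      hf.comp (d.continuousOn_symm.mono inter_subset_left) fun z hz => hz.2
    have hi : InjOn (f ∘ d.symm) (d.target ∩ d.symm ⁻¹' s) := fun u hu v hv huv =>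
      d.symm.injOn hu.1 hv.1 (hinj hu.2 hv.2 huv)
    have hcof := hl.trans (nhdsNE_le_cofinite (d p))
    have h1 := MapClusterPt.tendsto_of_injOn hX hcof hl' hmem hc hi hx
    have h2 := MapClusterPt.tendsto_of_injOn hX hcof hl' hmem hc hi hy
    have : (Filter.map (f ∘ d.symm) l).NeBot := Filter.NeBot.mono hx inf_le_right
    have : l.NeBot := Filter.map_neBot_iff _ |>.1 this
    exact tendsto_nhds_unique h1 h2
  have hleft := key (𝓝[<] (d p)) (nhdsWithin_mono _ fun z hz => ne_of_lt hz) fun s hs => by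
    obtain ⟨a, ha, has⟩ := (mem_nhdsLT_iff_exists_Ioo_subset).1 hs
    exact ⟨Ioo a (d p), Ioo_mem_nhdsLT ha, has, isPreconnected_Ioo⟩
  have hright := key (𝓝[>] (d p)) (nhdsWithin_mono _ fun z hz => ne_of_gt hz) fun s hs => by
    obtain ⟨a, ha, has⟩ := (mem_nhdsGT_iff_exists_Ioo_subset).1 hs
    exact ⟨Ioo (d p) a, Ioo_mem_nhdsGT ha, has, isPreconnected_Ioo⟩
  refine (hleft.finite.union hright.finite).subset fun x hx => ?_
  have hmap : Filter.map f (𝓝[≠] p) ≤ Filter.map (f ∘ d.symm) (𝓝[≠] (d p)) := by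
    rw [← Filter.map_map]
    refine Filter.map_mono fun U hU => ?_
    have h1 : Filter.Tendsto d (𝓝[≠] p) (𝓝[≠] (d p)) := by
      refine tendsto_nhdsWithin_iff.2 ⟨(d.continuousAt hpd).mono_left nhdsWithin_le_nhds, ?_⟩
      filter_upwards [mem_nhdsWithin_of_mem_nhds (d.open_source.mem_nhds hpd),
        self_mem_nhdsWithin] with z hz hz' h
      exact hz' (d.injOn hz hpd h)
    filter_upwards [h1 hU, mem_nhdsWithin_of_mem_nhds (d.open_source.mem_nhds hpd)] with z hz hz'
    simpa [d.left_inv hz'] using hz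
  have hx' : ClusterPt x (Filter.map (f ∘ d.symm) (𝓝[≠] (d p))) := ClusterPt.mono hx hmap
  rw [← Iio_union_Ioi, nhdsWithin_union, Filter.map_sup, clusterPt_sup] at hx'
  exact hx'

/-- An isolated point would give an open singleton in `ℝ`. Isolated points are to be excluded
because agreement off a finite set says nothing about values there. -/
theorem neBot_nhdsNE_of_chart {X : Type*} [TopologicalSpace X] {x : X}
    (d : OpenPartialHomeomorph X ℝ) (hx : x ∈ d.source) : (𝓝[≠] x).NeBot := by
  by_contra h
  have h1 : IsOpen (d '' {x}) := d.isOpen_image_of_subset_source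
    ((isOpen_singleton_iff_punctured_nhds x).2 (Filter.not_neBot.1 h)) (singleton_subset_iff.2 hx)
  rw [image_singleton] at h1
  exact not_isOpen_singleton _ h1

/-! ### Partial actions and their globalization -/

/-- A partial action of the group `Γ` on `X`: `rel g x y` means that `g` is defined at `x`, with
value `y`. -/
structure PartialAction (Γ X : Type*) [Group Γ] where
  rel : Γ → X → X → Prop
  rel_one : ∀ x, rel 1 x x
  rel_inv : ∀ {g x y}, rel g x y → rel g⁻¹ y x
  rel_mul : ∀ {g h x y z}, rel h x y → rel g y z → rel (g * h) x z
  eq_of_rel_one : ∀ {x y}, rel 1 x y → x = y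

namespace PartialAction

/-! ### The globalization as a `Γ`-set -/

section Algebra

variable {Γ X : Type*} [Group Γ] (P : PartialAction Γ X)

theorem rel_unique {g : Γ} {x y z : X} (h : P.rel g x y) (h' : P.rel g x z) : y = z := by
  have := P.rel_mul (P.rel_inv h) h'
  rw [mul_inv_cancel] at this
  exact P.eq_of_rel_one this

/-- The equivalence relation whose quotient is the universal globalization. -/
def setoid : Setoid (Γ × X) where
  r p q := P.rel (q.1⁻¹ * p.1) p.2 q.2
  iseqv :=
    { refl := fun p => by simpa using P.rel_one p.2
      symm := fun {p q} h => by simpa using P.rel_inv h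
      trans := fun {p q r} h h' => by simpa [mul_assoc] using P.rel_mul h h' }

/-- The universal globalization of a partial action. -/
def Glob : Type _ := Quotient P.setoid

/-- The map `x ↦ g x` from `X` to the globalization. -/
def incl (g : Γ) (x : X) : P.Glob := Quotient.mk P.setoid (g, x)

variable {P}

theorem incl_eq_iff {g h : Γ} {x y : X} : P.incl g x = P.incl h y ↔ P.rel (h⁻¹ * g) x y :=
  Quotient.eq (r := P.setoid)

theorem exists_incl_eq (b : P.Glob) : ∃ g x, P.incl g x = b := by
  induction b using Quotient.inductionOn with
  | h p => exact ⟨p.1, p.2, rfl⟩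

theorem incl_injective (g : Γ) : Function.Injective (P.incl g) := fun x y h => by
  rw [incl_eq_iff, inv_mul_cancel] at h
  exact P.eq_of_rel_one h

instance : MulAction Γ P.Glob where
  smul g := Quotient.map (fun p => (g * p.1, p.2)) fun p q h => by
    change P.rel ((g * q.1)⁻¹ * (g * p.1)) p.2 q.2
    rw [mul_inv_rev, mul_assoc, inv_mul_cancel_left]
    exact h
  one_smul b := by
    obtain ⟨h, x, rfl⟩ := exists_incl_eq b
    change P.incl (1 * h) x = _
    rw [one_mul]
  mul_smul g g' b := by
    obtain ⟨h, x, rfl⟩ := exists_incl_eq b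
    change P.incl (g * g' * h) x = P.incl (g * (g' * h)) x
    rw [mul_assoc]

@[simp]
theorem smul_incl (g h : Γ) (x : X) : g • P.incl h x = P.incl (g * h) x := rfl

/-- Translation by `g * h⁻¹` carries the copy `hX` to `gX`, so an invariant set has the same trace
on all copies of `X`. -/
theorem mem_iff_of_invariant {B : Set P.Glob} (hB : ∀ g : Γ, g • B = B) (g h : Γ) (x : X) :
    P.incl g x ∈ B ↔ P.incl h x ∈ B := by
  conv_lhs => rw [← hB (g * h⁻¹)]
  rw [mem_smul_set_iff_inv_smul_mem, smul_incl]
  simp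

/-- If every group element is defined on a cofinite subset then `X` is commensurated in its
globalization. -/
theorem finite_range_symmDiff_smul (hP : ∀ g, {x | ¬ ∃ y, P.rel g x y}.Finite) (g : Γ) :
    (range (P.incl 1) ∆ (g • range (P.incl 1))).Finite := by
  -- A point of `X` outside `gX` is one where `g⁻¹` is undefined.
  have key : ∀ g : Γ, (range (P.incl 1) \ (g • range (P.incl 1))).Finite := by
    intro g
    refine ((hP g⁻¹).image (P.incl 1)).subset ?_
    rintro _ ⟨⟨x, rfl⟩, hx⟩
    refine ⟨x, fun ⟨y, hy⟩ => hx ?_, rfl⟩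
    rw [mem_smul_set_iff_inv_smul_mem, smul_incl]
    exact ⟨y, (incl_eq_iff.2 (by simpa using hy)).symm⟩
  -- The other half, `gX \ X`, is the `g`-translate of `X \ g⁻¹X`.
  refine (key g).union (((key g⁻¹).image (g • ·)).subset ?_)
  rintro _ ⟨⟨a, ha, rfl⟩, hx⟩
  refine ⟨a, ⟨ha, fun h => hx ?_⟩, rfl⟩
  rw [mem_smul_set_iff_inv_smul_mem, inv_inv] at h
  exact h

end Algebra

/-! ### Topology of the globalization and removal of nonseparated points -/

section Topology

variable {Γ X : Type*} [Group Γ] [TopologicalSpace X] {P : PartialAction Γ X}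

instance : TopologicalSpace P.Glob := ⨆ g, TopologicalSpace.coinduced (P.incl g) inferInstance

theorem isOpen_glob_iff {U : Set P.Glob} : IsOpen U ↔ ∀ g, IsOpen (P.incl g ⁻¹' U) := by
  simp only [isOpen_iSup_iff, isOpen_coinduced]

theorem continuous_incl (g : Γ) : Continuous (P.incl g) :=
  continuous_def.2 fun _ hU => isOpen_glob_iff.1 hU g

/-- The trace on `hX` of the copy `gU` is the image of `U` under the partial map `h⁻¹g`, which is
open by `hP`. So every copy of `X` sits as an open subset. -/
theorem isOpenEmbedding_incl
    (hP : ∀ g U, IsOpen U → IsOpen {y | ∃ x ∈ U, P.rel g x y}) (g : Γ) :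
    IsOpenEmbedding (P.incl g) := by
  refine .of_continuous_injective_isOpenMap (continuous_incl g) (incl_injective g) fun U hU => ?_
  rw [isOpen_glob_iff]
  intro h
  convert hP (h⁻¹ * g) U hU using 1
  ext y
  exact exists_congr fun x => and_congr_right fun _ => incl_eq_iff

instance : ContinuousConstSMul Γ P.Glob where
  continuous_const_smul g := continuous_def.2 fun _ hU => isOpen_glob_iff.2 fun h =>
    isOpen_glob_iff.1 hU (g * h)

/-- An invariant subset of the globalization that contains almost all points of `X` is open. -/
theorem isOpen_of_invariant [T1Space X] {B : Set P.Glob} (hB : ∀ g : Γ, g • B = B)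
    (hfin : (P.incl 1 ⁻¹' B)ᶜ.Finite) : IsOpen B := by
  refine isOpen_glob_iff.2 fun g => ?_
  have : P.incl g ⁻¹' B = P.incl 1 ⁻¹' B := by
    ext x
    exact mem_iff_of_invariant hB g 1 x
  rw [this]
  exact isClosed_compl_iff.1 hfin.isClosed

variable (P) in
/-- The points of `B` that cannot be separated from another point of `B`. -/
def nonseparated (B : Set P.Glob) : Set P.Glob :=
  {b ∈ B | ∃ b' ∈ B, b ≠ b' ∧ ¬ Disjoint (𝓝 b) (𝓝 b')}

/-- `Γ` acts by homeomorphisms preserving `B`. This is what keeps `B` invariant after the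
nonseparated points are removed. -/
theorem smul_nonseparated {B : Set P.Glob} (hB : ∀ g : Γ, g • B = B) (g : Γ) :
    g • P.nonseparated B = P.nonseparated B := by
  have hmem : ∀ (g : Γ) {b}, b ∈ B → g • b ∈ B := fun g b hb => by
    rw [← hB g]; exact smul_mem_smul_set hb
  have key : ∀ (g : Γ) b, b ∈ P.nonseparated B → g • b ∈ P.nonseparated B := by
    rintro g b ⟨hb, b', hb', hne, hdis⟩
    refine ⟨hmem g hb, g • b', hmem g hb', fun h => hne (smul_left_cancel g h), fun h => hdis ?_⟩
    have h1 : ∀ c : P.Glob, 𝓝 (g • c) = Filter.map (g • ·) (𝓝 c) := fun c =>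
      ((Homeomorph.smul g).map_nhds_eq c).symm
    rwa [h1, h1, Filter.disjoint_map (MulAction.injective g)] at h
  ext b
  rw [mem_smul_set_iff_inv_smul_mem]
  exact ⟨fun h => by simpa using key g _ h, key g⁻¹ b⟩

/-- The points of `X` that cannot be separated from a point outside `X` are finitely many. -/
theorem finite_not_disjoint_nhds [T2Space X]
    (hX : ∀ x : X, ∃ d : OpenPartialHomeomorph X ℝ, x ∈ d.source)
    (hopen : ∀ g U, IsOpen U → IsOpen {y | ∃ x ∈ U, P.rel g x y})
    (hP : ∀ g, ∃ f : OpenPartialHomeomorph X X, f.sourceᶜ.Finite ∧ ∀ x ∈ f.source, P.rel g x (f x))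
    (b : P.Glob) (hb : b ∉ range (P.incl 1)) :
    {x | ¬ Disjoint (𝓝 (P.incl 1 x)) (𝓝 b)}.Finite := by
  obtain ⟨g, p, rfl⟩ := exists_incl_eq b
  obtain ⟨f, hf, hfP⟩ := hP g
  -- `g` is undefined at `p` because `gp` lies outside `X`, but `f` is defined on a punctured
  -- neighborhood of `p`.
  have hs : f.source ∈ 𝓝[≠] p := nhdsNE_le_cofinite p (by simpa using hf)
  refine (finite_mapClusterPt_nhdsNE hX hs f.continuousOn f.injOn).subset fun x hx => ?_
  refine mapClusterPt_iff_frequently.2 fun V hV => Filter.frequently_iff.2 fun {U} hU => ?_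
  by_contra! h
  refine hx (Filter.disjoint_iff.2 ⟨P.incl 1 '' V, ?_, P.incl g '' insert p (U ∩ f.source), ?_, ?_⟩)
  · rw [← (isOpenEmbedding_incl hopen 1).map_nhds_eq]
    exact Filter.image_mem_map hV
  · rw [← (isOpenEmbedding_incl hopen g).map_nhds_eq]
    exact Filter.image_mem_map (insert_mem_nhds_iff.2 (Filter.inter_mem hU hs))
  · rw [Set.disjoint_left]
    rintro _ ⟨v, hv, rfl⟩ ⟨u, hu, huv⟩
    rcases hu with rfl | ⟨hu, hus⟩
    · exact hb ⟨v, huv.symm⟩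
    · have h1 : P.rel g u v := by simpa using incl_eq_iff.1 huv
      exact h u hu (P.rel_unique (hfP u hus) h1 ▸ hv)

/-- Property FW provides an invariant, open, Hausdorff subset of the globalization that coincides
with `X` up to finitely many points. -/
theorem exists_invariant_t2 {Γ X : Type u} [Group Γ] (hΓ : PropertyFW Γ) [TopologicalSpace X]
    [T2Space X] {P : PartialAction Γ X}
    (hX : ∀ x : X, ∃ d : OpenPartialHomeomorph X ℝ, x ∈ d.source)
    (hopen : ∀ g U, IsOpen U → IsOpen {y | ∃ x ∈ U, P.rel g x y})
    (hP : ∀ g, ∃ f : OpenPartialHomeomorph X X,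
      f.sourceᶜ.Finite ∧ ∀ x ∈ f.source, P.rel g x (f x)) :
    ∃ Y : Set P.Glob, IsOpen Y ∧ (∀ g : Γ, g • Y = Y) ∧ T2Space Y ∧ (P.incl 1 ⁻¹' Y)ᶜ.Finite ∧
      (Y \ range (P.incl 1)).Finite := by
  obtain ⟨B, hB, hfin⟩ := hΓ P.Glob (range (P.incl 1)) (finite_range_symmDiff_smul fun g => by
    obtain ⟨f, hf, hfP⟩ := hP g
    exact hf.subset fun x hx hxf => hx ⟨_, hfP x hxf⟩)
  have hF : (B \ range (P.incl 1)).Finite := hfin.subset subset_union_right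
  have hF' : (range (P.incl 1) \ B).Finite := hfin.subset subset_union_left
  have hemb := isOpenEmbedding_incl hopen 1
  -- Two points of `X` are always separated, `X` being Hausdorff and open in the globalization. So a
  -- nonseparated pair involves one of the finitely many points of `B \ X`.
  have hN : (P.nonseparated B).Finite := by
    refine (hF.union (hF.biUnion fun b hb =>
      (finite_not_disjoint_nhds hX hopen hP b hb.2).image (P.incl 1))).subset ?_
    rintro b ⟨hb, b', hb', hne, hdis⟩
    by_cases hbr : b ∈ range (P.incl 1)
    · obtain ⟨x, rfl⟩ := hbr
      refine Or.inr (mem_biUnion (x := b') ⟨hb', ?_⟩ ⟨x, hdis, rfl⟩)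
      rintro ⟨x', rfl⟩
      rw [← hemb.map_nhds_eq, ← hemb.map_nhds_eq, Filter.disjoint_map hemb.injective] at hdis
      exact hdis (disjoint_nhds_nhds.2 fun h => hne (congrArg _ h))
    · exact Or.inl ⟨hb, hbr⟩
  have hinv : ∀ g : Γ, g • (B \ P.nonseparated B) = B \ P.nonseparated B := fun g => by
    rw [smul_set_sdiff, hB, smul_nonseparated hB]
  have hcof : (P.incl 1 ⁻¹' (B \ P.nonseparated B))ᶜ.Finite := by
    refine ((hF'.preimage (incl_injective 1).injOn).union
      (hN.preimage (incl_injective 1).injOn)).subset fun x hx => ?_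
    by_cases hxB : P.incl 1 x ∈ B
    · refine Or.inr ?_
      by_contra h
      exact hx ⟨hxB, h⟩
    · exact Or.inl ⟨mem_range_self x, hxB⟩
  refine ⟨B \ P.nonseparated B, isOpen_of_invariant hinv hcof, hinv, ?_, hcof,
    hF.subset fun b hb => ⟨hb.1.1, hb.2⟩⟩
  refine t2Space_iff_disjoint_nhds.2 fun y y' hne => ?_
  simp only [nhds_subtype]
  refine Filter.disjoint_comap ?_
  by_contra h
  exact y.2.2 ⟨y.2.1, y', y'.2.1, fun h => hne (Subtype.ext h), h⟩

end Topology

end PartialAction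

/-! ### Structure groupoids closed under restriction -/

instance closedUnderRestriction_locallyInGroupoid {H : Type*} [TopologicalSpace H]
    (T : Subgroup (Equiv.Perm H)) : ClosedUnderRestriction (locallyInGroupoid T) where
  closedUnderRestriction := fun he _ _ x hx => he x hx.1

instance : ClosedUnderRestriction Aff := closedUnderRestriction_locallyInGroupoid _

instance : ClosedUnderRestriction Proj := closedUnderRestriction_locallyInGroupoid _

section Groupoid

variable {H : Type*} [TopologicalSpace H] {G : StructureGroupoid H} [ClosedUnderRestriction G]

/-- A homeomorphism that coincides near every point with a member of `G` belongs to `G`. -/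
theorem StructureGroupoid.mem_of_locally_eqOn {e : OpenPartialHomeomorph H H}
    (h : ∀ x ∈ e.source, ∃ e' ∈ G, ∃ s, IsOpen s ∧ x ∈ s ∧ x ∈ e'.source ∧
      EqOn e e' (e.source ∩ e'.source ∩ s)) : e ∈ G := by
  refine G.locality fun x hx => ?_
  obtain ⟨e', he', s, hs, hxs, hxe', heq⟩ := h x hx
  have ho : IsOpen (e'.source ∩ s) := e'.open_source.inter hs
  refine ⟨e'.source ∩ s, ho, ⟨hxe', hxs⟩, G.mem_of_eqOnSource
    (closedUnderRestriction' he' (e.open_source.inter hs)) ⟨?_, ?_⟩⟩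
  · rw [OpenPartialHomeomorph.restr_source' _ _ ho,
      OpenPartialHomeomorph.restr_source' _ _ (e.open_source.inter hs)]
    ext y
    simp only [mem_inter_iff]
    tauto
  · intro y hy
    rw [OpenPartialHomeomorph.restr_source' _ _ ho] at hy
    exact heq ⟨⟨hy.1, hy.2.1⟩, hy.2.2⟩

variable {X Y : Type*} [TopologicalSpace X] [ChartedSpace H X] [TopologicalSpace Y]
  [ChartedSpace H Y]

/-- A homeomorphism between open subsets of `X` that coincides near every point with an
isomorphism between cofinite subsets belongs to `G` in all the charts. -/
theorem CofiniteIso.mem_groupoid_of_locally_eqOn {e : OpenPartialHomeomorph X Y}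
    (h : ∀ x ∈ e.source, ∃ f : CofiniteIso G X Y, x ∈ f.map.source ∧
      EqOn e f.map (e.source ∩ f.map.source))
    {c : OpenPartialHomeomorph X H} (hc : c ∈ G.maximalAtlas X)
    {c' : OpenPartialHomeomorph Y H} (hc' : c' ∈ G.maximalAtlas Y) : c.symm ≫ₕ e ≫ₕ c' ∈ G := by
  refine StructureGroupoid.mem_of_locally_eqOn fun x hx => ?_
  simp only [OpenPartialHomeomorph.trans_source, mem_inter_iff, mem_preimage,
    OpenPartialHomeomorph.symm_source] at hx
  obtain ⟨f, hxf, heq⟩ := h _ hx.2.1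
  -- `f` is controlled only in charts of the atlases, so the expression in `c`, `c'` is factored
  -- through atlas charts `k`, `k'`.
  let k := chartAt H (c.symm x)
  let k' := chartAt H (f.map (c.symm x))
  have hk : k ∈ atlas H X := chart_mem_atlas _ _
  have hk' : k' ∈ atlas H Y := chart_mem_atlas _ _
  have hxk : c.symm x ∈ k.source := mem_chart_source _ _
  have hxk' : f.map (c.symm x) ∈ k'.source := mem_chart_source _ _
  have hex : e (c.symm x) = f.map (c.symm x) := heq ⟨hx.2.1, hxf⟩
  refine ⟨(c.symm ≫ₕ k) ≫ₕ (k.symm ≫ₕ f.map ≫ₕ k') ≫ₕ (k'.symm ≫ₕ c'),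
    G.trans (hc k hk).1 (G.trans (f.mem_groupoid k hk k' hk') (hc' k' hk').2),
    univ, isOpen_univ, mem_univ _, ?_, ?_⟩
  · have := hx.2.2
    rw [hex] at this
    simp [hx.1, hxk, hxf, hxk', this]
  · intro y hy
    simp only [OpenPartialHomeomorph.trans_source, mem_inter_iff, mem_preimage,
      OpenPartialHomeomorph.symm_source, OpenPartialHomeomorph.coe_trans, Function.comp_apply]
      at hy
    obtain ⟨⟨⟨h1, h2, h3⟩, ⟨-, h4⟩, ⟨⟨h5, h6, h7⟩, -⟩⟩, -⟩ := hy
    rw [k.left_inv h4] at h6 h7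
    simp only [OpenPartialHomeomorph.coe_trans, Function.comp_apply, k.left_inv h4,
      k'.left_inv h7]
    rw [heq ⟨h2, h6⟩]

end Groupoid

/-! ### Manifolds covered by pieces of another manifold -/

section Cover

variable {H X Y ι : Type*} [TopologicalSpace H] [TopologicalSpace X] [ChartedSpace H X]
  [TopologicalSpace Y]

/-- The charted space structure on a space `Y` covered by open subsets that are identified with
open subsets of a charted space `X`. -/
@[reducible]
noncomputable def ChartedSpace.ofCover (κ : ι → OpenPartialHomeomorph Y X)
    (hκ : ∀ y, ∃ i, y ∈ (κ i).source) : ChartedSpace H Y where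
  atlas := {e | ∃ i, ∃ c ∈ atlas H X, e = κ i ≫ₕ c}
  chartAt y := κ (hκ y).choose ≫ₕ chartAt H (κ (hκ y).choose y)
  mem_chart_source y := by simpa using (hκ y).choose_spec
  chart_mem_atlas y := ⟨_, _, chart_mem_atlas _ _, rfl⟩

end Cover

/-! ### Finite coverings by bounded charts -/

section Bounded

variable {H : Type*} [TopologicalSpace H] {ι : ℝ → H} {X : Type*} [TopologicalSpace X]

/-- The set `W` is the union of the domains of finitely many bounded charts among `A`. -/
def CoveredByBoundedCharts (ι : ℝ → H) (A : Set (OpenPartialHomeomorph X H)) (W : Set X) : Prop :=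
  ∃ S : Set (OpenPartialHomeomorph X H), S.Finite ∧ S ⊆ A ∧ (⋃ e ∈ S, e.source) = W ∧
    ∀ e ∈ S, IsPreconnected e.source ∧ ∃ a b : ℝ, e.target ⊆ ι '' Ioo a b

theorem CoveredByBoundedCharts.iUnion {A : Set (OpenPartialHomeomorph X H)} {I : Type*} {J : Set I}
    (hJ : J.Finite) {W : I → Set X} (h : ∀ i ∈ J, CoveredByBoundedCharts ι A (W i)) :
    CoveredByBoundedCharts ι A (⋃ i ∈ J, W i) := by
  choose! S hS using h
  refine ⟨⋃ i ∈ J, S i, hJ.biUnion fun i hi => (hS i hi).1,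
    iUnion₂_subset fun i hi => (hS i hi).2.1, ?_, ?_⟩
  · ext x
    simp only [mem_iUnion, exists_prop]
    constructor
    · rintro ⟨e, ⟨i, hi, he⟩, hx⟩
      exact ⟨i, hi, (hS i hi).2.2.1 ▸ mem_biUnion he hx⟩
    · rintro ⟨i, hi, hx⟩
      rw [← (hS i hi).2.2.1] at hx
      obtain ⟨e, he, hx⟩ := mem_iUnion₂.1 hx
      exact ⟨e, ⟨i, hi, he⟩, hx⟩
  · intro e he
    obtain ⟨i, hi, he⟩ := mem_iUnion₂.1 he
    exact (hS i hi).2.2.2 e he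

/-- On the line, intersections of intervals are intervals. Arcs of the projective line can meet in
two pieces, hence the reading of charts in `ℝ`. -/
theorem OpenPartialHomeomorph.isPreconnected_source_inter_preimage
    {d : OpenPartialHomeomorph X ℝ} (hd : IsPreconnected d.source) {I : Set ℝ} (hI : I.OrdConnected) :
    IsPreconnected (d.source ∩ d ⁻¹' I) := by
  have h1 : IsPreconnected d.target := d.image_source_eq_target ▸ hd.image _ d.continuousOn
  have h2 : IsPreconnected (d.target ∩ I) := (h1.ordConnected.inter hI).isPreconnected
  convert h2.image _ (d.continuousOn_symm.mono inter_subset_left) using 1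
  rw [d.symm_image_target_inter_eq]
  ext x
  exact and_congr_right fun hx => (and_iff_right (d.map_source hx)).symm

/-- A bounded chart can be read in the real line. -/
theorem exists_real_chart (hι : IsOpenEmbedding ι) (e : OpenPartialHomeomorph X H)
    (he : e.target ⊆ range ι) : ∃ d : OpenPartialHomeomorph X ℝ, d.source = e.source := by
  refine ⟨e ≫ₕ (hι.toOpenPartialHomeomorph ι).symm, ?_⟩
  simp only [OpenPartialHomeomorph.trans_source, OpenPartialHomeomorph.symm_source,
    IsOpenEmbedding.toOpenPartialHomeomorph_target]
  exact inter_eq_left.2 fun x hx => he (e.map_source hx)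

/-- A chart domain containing `x` is replaced by its two parts, left and right of `x` in a real
coordinate; the other charts are kept. -/
theorem CoveredByBoundedCharts.diff_singleton (hι : IsOpenEmbedding ι)
    {A : Set (OpenPartialHomeomorph X H)} (hA : ∀ e ∈ A, ∀ s, IsOpen s → e.restr s ∈ A) {W : Set X}
    (hW : CoveredByBoundedCharts ι A W) (x : X) : CoveredByBoundedCharts ι A (W \ {x}) := by
  obtain ⟨S, hSfin, hSA, rfl, hS⟩ := hW
  have hdiff : (⋃ e ∈ S, e.source) \ {x} = ⋃ e ∈ S, e.source \ {x} := by
    simp only [sdiff_eq, iUnion_inter]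
  rw [hdiff]
  refine CoveredByBoundedCharts.iUnion hSfin fun e he => ?_
  obtain ⟨hec, a, b, hab⟩ := hS e he
  obtain ⟨d, hd⟩ := exists_real_chart hι e (hab.trans (image_subset_range _ _))
  by_cases hx : x ∈ e.source
  swap
  · refine ⟨{e}, finite_singleton _, singleton_subset_iff.2 (hSA he), by simp [hx], ?_⟩
    rintro _ rfl
    exact hS _ he
  have ho : ∀ I : Set ℝ, IsOpen I → IsOpen (e.source ∩ d ⁻¹' I) := fun I hI =>
    hd ▸ d.isOpen_inter_preimage hI
  let r (I : Set ℝ) := e.restr (e.source ∩ d ⁻¹' I)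
  have hr : ∀ I : Set ℝ, IsOpen I → (r I).source = e.source ∩ d ⁻¹' I := fun I hI => by
    rw [OpenPartialHomeomorph.restr_source' _ _ (ho I hI), ← inter_assoc, inter_self]
  refine ⟨{r (Iio (d x)), r (Ioi (d x))}, by simp, ?_, ?_, ?_⟩
  · rintro _ (rfl | rfl)
    · exact hA e (hSA he) _ (ho _ isOpen_Iio)
    · exact hA e (hSA he) _ (ho _ isOpen_Ioi)
  · rw [biUnion_pair, hr _ isOpen_Iio, hr _ isOpen_Ioi, ← inter_union_distrib_left,
      ← preimage_union, Iio_union_Ioi]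
    ext y
    refine and_congr_right fun hy => not_congr ?_
    exact d.injOn.eq_iff (hd ▸ hy) (hd ▸ hx)
  · have key : ∀ I : Set ℝ, IsOpen I → I.OrdConnected →
        IsPreconnected (r I).source ∧ ∃ a b : ℝ, (r I).target ⊆ ι '' Ioo a b := by
      refine fun I hI hI' => ⟨?_, a, b, Subset.trans ?_ hab⟩
      · rw [hr I hI, ← hd]
        exact OpenPartialHomeomorph.isPreconnected_source_inter_preimage (hd ▸ hec) hI'
      · exact inter_subset_left
    rintro _ (rfl | rfl)
    · exact key _ isOpen_Iio ordConnected_Iio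
    · exact key _ isOpen_Ioi ordConnected_Ioi

theorem CoveredByBoundedCharts.diff_finite (hι : IsOpenEmbedding ι)
    {A : Set (OpenPartialHomeomorph X H)} (hA : ∀ e ∈ A, ∀ s, IsOpen s → e.restr s ∈ A) {W D : Set X}
    (hW : CoveredByBoundedCharts ι A W) (hD : D.Finite) : CoveredByBoundedCharts ι A (W \ D) := by
  induction D, hD using Set.Finite.induction_on with
  | empty => simpa using hW
  | insert _ _ ih =>
    rw [← union_singleton, ← sdiff_sdiff]
    exact ih.diff_singleton hι hA _

/-- Transport of a covering by bounded charts through a homeomorphism between open subsets. -/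
theorem CoveredByBoundedCharts.comp {Y : Type*} [TopologicalSpace Y]
    {A : Set (OpenPartialHomeomorph X H)} {A' : Set (OpenPartialHomeomorph Y H)}
    (κ : OpenPartialHomeomorph Y X) (hκ : ∀ e ∈ A, κ ≫ₕ e ∈ A')
    (h : CoveredByBoundedCharts ι A κ.target) : CoveredByBoundedCharts ι A' κ.source := by
  obtain ⟨S, hSfin, hSA, hSW, hS⟩ := h
  -- Each domain lies in `κ.target`, so its pullback is a continuous image under `κ.symm` and stays
  -- preconnected.
  have hsub : ∀ e ∈ S, e.source ⊆ κ.target := fun e he => hSW ▸ subset_biUnion_of_mem (u := fun e => e.source) he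
  refine ⟨(κ ≫ₕ ·) '' S, hSfin.image _, ?_, ?_, ?_⟩
  · rintro _ ⟨e, he, rfl⟩
    exact hκ e (hSA he)
  · rw [biUnion_image]
    ext y
    simp only [OpenPartialHomeomorph.trans_source, mem_iUnion, exists_prop, mem_inter_iff,
      mem_preimage]
    constructor
    · rintro ⟨e, -, h, -⟩
      exact h
    · intro hy
      have := κ.map_source hy
      rw [← hSW] at this
      obtain ⟨e, he, h⟩ := mem_iUnion₂.1 this
      exact ⟨e, he, hy, h⟩
  · rintro _ ⟨e, he, rfl⟩
    obtain ⟨hec, a, b, hab⟩ := hS e he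
    refine ⟨?_, a, b, fun z hz => hab ?_⟩
    · dsimp only
      rw [OpenPartialHomeomorph.trans_source, ← κ.symm_image_eq_source_inter_preimage (hsub e he)]
      exact hec.image _ (κ.continuousOn_symm.mono (hsub e he))
    · rw [OpenPartialHomeomorph.trans_target] at hz
      exact hz.1

end Bounded

/-! ### The partial action defined by piecewise transformations -/

section PiecewiseAction

variable {H : Type*} [TopologicalSpace H] {G : StructureGroupoid H}

/-- Two isomorphisms between cofinite subsets of Hausdorff spaces without isolated points that agree
on a cofinite subset agree wherever they are both defined. -/
theorem CofiniteIso.Agree.eq {X Y : Type*} [TopologicalSpace X] [ChartedSpace H X]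
    [TopologicalSpace Y] [ChartedSpace H Y] [T1Space X] [T2Space Y] {f f' : CofiniteIso G X Y}
    (h : CofiniteIso.Agree f f') {x : X} [(𝓝[≠] x).NeBot] (hx : x ∈ f.map.source)
    (hx' : x ∈ f'.map.source) : f.map x = f'.map x := by
  refine tendsto_nhds_unique_of_eventuallyEq
    ((f.map.continuousAt hx).mono_left (nhdsWithin_le_nhds (s := {x}ᶜ)))
    ((f'.map.continuousAt hx').mono_left nhdsWithin_le_nhds) ?_
  filter_upwards [nhdsNE_le_cofinite x h.compl_mem_cofinite] with y hy
  rw [compl_compl] at hy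
  exact hy.2.2

variable {Γ X : Type*} [Group Γ] [TopologicalSpace X] [T2Space X] [ChartedSpace H X]
  [HasGroupoid X G]

/-- The partial action on a Hausdorff space without isolated points defined by a group of piecewise
transformations. -/
def PartialAction.ofPC (hX : ∀ x : X, (𝓝[≠] x).NeBot) (ρ : Γ →* PC G X) : PartialAction Γ X where
  -- All representatives are allowed, so `g` is defined on the union of their domains.
  rel g x y := ∃ f : CofiniteIso G X X, Quotient.mk _ f = ρ g ∧ x ∈ f.map.source ∧ f.map x = y
  rel_one x := ⟨CofiniteIso.ofStructomorph (Structomorph.refl X), (map_one ρ).symm, mem_univ _, rfl⟩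
  rel_inv := by
    rintro g _ _ ⟨f, hf, hx, rfl⟩
    refine ⟨f.symm, ?_, f.map.map_source hx, f.map.left_inv hx⟩
    rw [map_inv, ← hf]
    rfl
  rel_mul := by
    rintro g h _ _ _ ⟨f, hf, hx, rfl⟩ ⟨f', hf', hx', rfl⟩
    refine ⟨f.trans f', ?_, ⟨hx, hx'⟩, rfl⟩
    rw [map_mul, ← hf, ← hf']
    rfl
  -- The only axiom needing the Hausdorff property and the absence of isolated points.
  eq_of_rel_one := by
    rintro x _ ⟨f, hf, hx, rfl⟩
    rw [map_one] at hf
    have := hX x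
    exact ((Quotient.exact hf : CofiniteIso.Agree _ _).eq hx (mem_univ x)).symm

variable {hX : ∀ x : X, (𝓝[≠] x).NeBot} {ρ : Γ →* PC G X}

theorem PartialAction.isOpen_ofPC (g : Γ) (U : Set X) (hU : IsOpen U) :
    IsOpen {y | ∃ x ∈ U, (PartialAction.ofPC hX ρ).rel g x y} := by
  refine isOpen_iff_mem_nhds.2 ?_
  rintro _ ⟨x, hx, f, hf, hxf, rfl⟩
  filter_upwards [f.map.image_mem_nhds hxf (Filter.inter_mem (f.map.open_source.mem_nhds hxf)
    (hU.mem_nhds hx))]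
  rintro _ ⟨x', hx', rfl⟩
  exact ⟨x', hx'.2, f, hf, hx'.1, rfl⟩

theorem PartialAction.exists_ofPC (g : Γ) : ∃ f : OpenPartialHomeomorph X X,
    f.sourceᶜ.Finite ∧ ∀ x ∈ f.source, (PartialAction.ofPC hX ρ).rel g x (f x) := by
  obtain ⟨f, hf⟩ := Quotient.exists_rep (ρ g)
  exact ⟨f.map, f.finite_source, fun x hx => ⟨f, hf, hx, rfl⟩⟩

/-- Values of the partial action being unique, `e` coincides near each point with a representative
of `ρ g`. Transitions between the copies of `X` are of this kind. -/
theorem PartialAction.mem_groupoid_of_rel_ofPC [ClosedUnderRestriction G]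
    {e : OpenPartialHomeomorph X X} {g : Γ}
    (h : ∀ x ∈ e.source, (PartialAction.ofPC hX ρ).rel g x (e x))
    {c c' : OpenPartialHomeomorph X H} (hc : c ∈ G.maximalAtlas X) (hc' : c' ∈ G.maximalAtlas X) :
    c.symm ≫ₕ e ≫ₕ c' ∈ G := by
  refine CofiniteIso.mem_groupoid_of_locally_eqOn (fun x hx => ?_) hc hc'
  obtain ⟨f, hf, hxf, -⟩ := h x hx
  exact ⟨f, hxf, fun z hz => PartialAction.rel_unique _ (h z hz.1) ⟨f, hf, hz.2, rfl⟩⟩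

end PiecewiseAction

/-- `κ` is the inverse of `x ↦ gx`, restricted to `Y ∩ gX`. These maps are the pieces from which the
atlas of `Y` is built. -/
theorem PartialAction.exists_openPartialHomeomorph {Γ X : Type*} [Group Γ] [TopologicalSpace X]
    [Nonempty X] {P : PartialAction Γ X}
    (hopen : ∀ g U, IsOpen U → IsOpen {y | ∃ x ∈ U, P.rel g x y}) {Y : Set P.Glob}
    (hY : IsOpen Y) (hne : Y.Nonempty) (g : Γ) :
    ∃ κ : OpenPartialHomeomorph Y X, κ.target = P.incl g ⁻¹' Y ∧
      (∀ y, y ∈ κ.source ↔ y.1 ∈ range (P.incl g)) ∧ ∀ y ∈ κ.source, P.incl g (κ y) = y := by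
  let U : TopologicalSpace.Opens P.Glob := ⟨Y, hY⟩
  have : Nonempty U := hne.to_subtype
  let e := (isOpenEmbedding_incl hopen g).toOpenPartialHomeomorph (P.incl g)
  have hsrc : ∀ y, y ∈ (e.symm.subtypeRestr (s := U) this).source ↔ y.1 ∈ range (P.incl g) := by
    intro y
    rw [OpenPartialHomeomorph.subtypeRestr_source, OpenPartialHomeomorph.symm_source,
      IsOpenEmbedding.toOpenPartialHomeomorph_target]
    rfl
  have happ : ∀ y ∈ (e.symm.subtypeRestr (s := U) this).source,
      P.incl g (e.symm.subtypeRestr (s := U) this y) = y := fun y hy =>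
    e.right_inv (by simpa [e] using (hsrc y).1 hy)
  refine ⟨e.symm.subtypeRestr (s := U) this, ?_, hsrc, happ⟩
  ext x
  constructor
  · intro hx
    have h1 := happ _ ((e.symm.subtypeRestr (s := U) this).map_target hx)
    rw [(e.symm.subtypeRestr (s := U) this).right_inv hx] at h1
    rw [mem_preimage, h1]
    exact Subtype.coe_prop _
  · intro hx
    have hy := (hsrc ⟨_, hx⟩).2 (mem_range_self x)
    have := (e.symm.subtypeRestr (s := U) this).map_source hy
    rwa [incl_injective g (happ _ hy)] at this

/-! ### Regularization -/

section Regularization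

variable {H : Type*} [TopologicalSpace H] (G : StructureGroupoid H) (ι : ℝ → H)

/-- The homomorphism `ρ` to the group of piecewise transformations of `X` is conjugate to an action
by automorphisms on a Hausdorff finitely-charted manifold. -/
def IsRegularizable {Γ X : Type u} [Group Γ] [TopologicalSpace X] [ChartedSpace H X]
    [HasGroupoid X G] (ρ : Γ →* PC G X) : Prop :=
  ∃ (Y : Type u) (_ : TopologicalSpace Y) (_ : ChartedSpace H Y) (_ : HasGroupoid Y G),
    T2Space Y ∧ FinitelyCharted G ι Y ∧ ∃ (φ : PCTrans G X Y) (β : Γ →* Structomorph G Y Y),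
      ∀ g : Γ, φ.conj (ρ g) = autToPC (β g)

variable {G ι}

theorem Structomorph.ext_apply {X : Type*} [TopologicalSpace X] [ChartedSpace H X]
    {f f' : Structomorph G X X} (h : ∀ x, f.toHomeomorph x = f'.toHomeomorph x) : f = f' := by
  have h1 : f.toHomeomorph = f'.toHomeomorph := Homeomorph.ext h
  cases f
  cases f'
  simp only at h1
  subst h1
  rfl

variable {Γ X : Type u} [Group Γ] [TopologicalSpace X] [T2Space X] [ChartedSpace H X]
  [HasGroupoid X G]

/-- Treated apart because the local inverses `κ` are built for nonempty spaces. Here `PC G X` is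
trivial and `Y = X` works. -/
theorem isRegularizable_of_isEmpty [IsEmpty X] (hX : FinitelyCharted G ι X) (ρ : Γ →* PC G X) :
    IsRegularizable G ι ρ := by
  refine ⟨X, _, _, inferInstance, inferInstance, hX,
    PCTrans.ofStructomorph (Structomorph.refl X), 1, fun g => ?_⟩
  have h : ∀ f f' : PC G X, f = f' := fun f f' => by
    induction f, f' using Quotient.inductionOn₂
    exact Quotient.sound (CofiniteIso.agree_of_eqOn fun x => isEmptyElim x)
  exact h _ _

/-- The geometric half of the argument: once `Y` is found, the maps `κ g` transport to it the
structure of `X` and its bounded charts. -/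
theorem isRegularizable_of_partialHomeomorph [ClosedUnderRestriction G] (hι : IsOpenEmbedding ι)
    (hFC : FinitelyCharted G ι X) {hX : ∀ x : X, (𝓝[≠] x).NeBot} {ρ : Γ →* PC G X}
    {P : PartialAction Γ X} (hP : P = PartialAction.ofPC hX ρ)
    {Y : Set P.Glob} (hY : ∀ g : Γ, g • Y = Y) [T2Space Y]
    (hcof : (P.incl 1 ⁻¹' Y)ᶜ.Finite)
    (hfin : (Y \ range (P.incl 1)).Finite)
    (κ : Γ → OpenPartialHomeomorph Y X)
    (htgt : ∀ g, (κ g).target = P.incl g ⁻¹' Y)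
    (hsrc : ∀ g y, y ∈ (κ g).source ↔ y.1 ∈ range (P.incl g))
    (happ : ∀ g, ∀ y ∈ (κ g).source, P.incl g (κ g y) = y) :
    IsRegularizable G ι ρ := by
  have hcover : ∀ y, ∃ g, y ∈ (κ g).source := fun y => by
    obtain ⟨g, x, hx⟩ := PartialAction.exists_incl_eq y.1
    exact ⟨g, (hsrc g y).2 ⟨x, hx⟩⟩
  have hsymm : ∀ g, ∀ x ∈ (κ g).target, ((κ g).symm x : P.Glob) = P.incl g x := fun g x hx => by
    rw [← happ g _ ((κ g).map_target hx), (κ g).right_inv hx]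
  let : ChartedSpace H Y := ChartedSpace.ofCover κ hcover
  have hmemY : ∀ (g : Γ) {b}, b ∈ Y → g • b ∈ Y := fun g b hb => by
    rw [← hY g]; exact smul_mem_smul_set hb
  -- transitions between the pieces of `Y`, possibly through the action
  have htrans : ∀ (g h k : Γ) (e : OpenPartialHomeomorph Y Y),
      (∀ y ∈ e.source, (e y : P.Glob) = k • (y : P.Glob)) →
      ∀ c ∈ G.maximalAtlas X, ∀ c' ∈ G.maximalAtlas X,
        (κ g ≫ₕ c).symm ≫ₕ e ≫ₕ (κ h ≫ₕ c') ∈ G := by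
    intro g h k e he c hc c' hc'
    -- If `e` acts as `k`, then read from the piece of `g` to that of `h` it is the partial map
    -- `h⁻¹kg` of `X`. Taking `k = 1` gives the compatibility of charts, and `e` the action of `k`
    -- gives the automorphisms.
    have h1 : c.symm ≫ₕ ((κ g).symm ≫ₕ e ≫ₕ κ h) ≫ₕ c' ∈ G := by
      refine PartialAction.mem_groupoid_of_rel_ofPC (hX := hX) (ρ := ρ) (g := h⁻¹ * (k * g))
        (fun x hx => hP ▸ ?_) hc hc'
      simp only [OpenPartialHomeomorph.trans_source, mem_inter_iff, mem_preimage,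
        OpenPartialHomeomorph.symm_source] at hx
      refine PartialAction.incl_eq_iff.1 ?_
      change P.incl (k * g) x = P.incl h (κ h (e ((κ g).symm x)))
      rw [happ h _ hx.2.2, he _ hx.2.1, hsymm g x hx.1, PartialAction.smul_incl]
    simpa only [OpenPartialHomeomorph.trans_symm_eq_symm_trans_symm,
      OpenPartialHomeomorph.trans_assoc] using h1
  have hcompat : ∀ (g h : Γ), ∀ c ∈ G.maximalAtlas X, ∀ c' ∈ G.maximalAtlas X,
      (κ g ≫ₕ c).symm ≫ₕ (κ h ≫ₕ c') ∈ G := by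
    intro g h c hc c' hc'
    simpa only [OpenPartialHomeomorph.refl_trans] using
      htrans g h 1 (OpenPartialHomeomorph.refl Y) (fun y _ => (one_smul Γ _).symm) c hc c' hc'
  have hatlas : ∀ c ∈ atlas H X, c ∈ G.maximalAtlas X := fun c hc =>
    G.subset_maximalAtlas hc
  have hgroupoid : HasGroupoid Y G := ⟨by
    rintro _ _ ⟨g, c, hc, rfl⟩ ⟨h, c', hc', rfl⟩
    exact hcompat g h c (hatlas c hc) c' (hatlas c' hc')⟩
  have hmax : ∀ (g : Γ), ∀ c ∈ G.maximalAtlas X, κ g ≫ₕ c ∈ G.maximalAtlas Y := by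
    rintro g c hc _ ⟨h, c', hc', rfl⟩
    exact ⟨hcompat g h c hc c' (hatlas c' hc'), hcompat h g c' (hatlas c' hc') c hc⟩
  refine ⟨Y, inferInstance, inferInstance, hgroupoid, inferInstance, ?_, ?_⟩
  · have hpiece : ∀ g, CoveredByBoundedCharts ι (G.maximalAtlas Y) (κ g).source := by
      refine fun g => CoveredByBoundedCharts.comp (A := G.maximalAtlas X) _ (hmax g) ?_
      have h1 : (κ g).target = univ \ (P.incl 1 ⁻¹' Y)ᶜ := by
        rw [htgt, ← compl_eq_univ_sdiff, compl_compl]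
        ext x
        exact PartialAction.mem_iff_of_invariant hY g 1 x
      rw [h1]
      exact CoveredByBoundedCharts.diff_finite hι
        (fun e he s hs => restr_mem_maximalAtlas G he hs) hFC hcof
    -- The piece of `1` misses finitely many points of `Y`; one further piece is added for each.
    choose γ hγ using id hcover
    have hJ : (insert (1 : Γ) (γ '' {y | y.1 ∉ range (P.incl 1)})).Finite := by
      refine ((Set.Finite.preimage Subtype.val_injective.injOn hfin).subset ?_).image γ |>.insert 1
      exact fun y hy => ⟨y.2, hy⟩
    have := CoveredByBoundedCharts.iUnion hJ fun g _ => hpiece g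
    suffices h : ⋃ g ∈ insert (1 : Γ) (γ '' {y | y.1 ∉ range (P.incl 1)}), (κ g).source = univ by
      rwa [h] at this
    refine eq_univ_of_forall fun y => ?_
    by_cases hy : y.1 ∈ range (P.incl 1)
    · exact mem_biUnion (mem_insert _ _) ((hsrc 1 y).2 hy)
    · exact mem_biUnion (mem_insert_of_mem _ ⟨y, hy, rfl⟩) (hγ y)
  · let φ : CofiniteIso G X Y :=
      { map := (κ 1).symm
        finite_source := by
          rw [OpenPartialHomeomorph.symm_source, htgt]
          exact hcof
        finite_target := by
          refine (Set.Finite.preimage Subtype.val_injective.injOn hfin).subset fun y hy => ?_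
          exact ⟨y.2, fun h => hy ((hsrc 1 y).2 h)⟩
        mem_groupoid := by
          rintro c hc _ ⟨h, c', hc', rfl⟩
          have := hcompat 1 h c (hatlas c hc) c' (hatlas c' hc')
          rwa [OpenPartialHomeomorph.trans_symm_eq_symm_trans_symm,
            OpenPartialHomeomorph.trans_assoc] at this }
    let σ (g : Γ) : Y ≃ₜ Y :=
      { toFun := fun y => ⟨g • y.1, hmemY g y.2⟩
        invFun := fun y => ⟨g⁻¹ • y.1, hmemY g⁻¹ y.2⟩
        left_inv := fun y => Subtype.ext (inv_smul_smul g y.1)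
        right_inv := fun y => Subtype.ext (smul_inv_smul g y.1)
        continuous_toFun := (continuous_subtype_val.const_smul g).subtype_mk _
        continuous_invFun := (continuous_subtype_val.const_smul g⁻¹).subtype_mk _ }
    let β : Γ →* Structomorph G Y Y := MonoidHom.mk' (fun g =>
      { σ g with
        mem_groupoid := by
          rintro _ _ ⟨g', c, hc, rfl⟩ ⟨h, c', hc', rfl⟩
          exact htrans g' h g (σ g).toOpenPartialHomeomorph (fun _ _ => rfl) c (hatlas c hc) c'
            (hatlas c' hc') })
      fun g h => Structomorph.ext_apply fun y => Subtype.ext (mul_smul g h y.1)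
    refine ⟨Quotient.mk _ φ, β, fun g => ?_⟩
    obtain ⟨f, hf⟩ := Quotient.exists_rep (ρ g)
    rw [← hf]
    -- Where both sides are defined, `y` is the class of `x = κ 1 y`, and `f x` in the copy of `1`
    -- is the same point as `x` in the copy of `g`, namely `g • y`.
    refine Quotient.sound (CofiniteIso.agree_of_eqOn fun y hy _ => Subtype.ext ?_)
    obtain ⟨⟨h1, h2⟩, h3⟩ : (y ∈ (κ 1).source ∧ κ 1 y ∈ f.map.source) ∧
      f.map (κ 1 y) ∈ (κ 1).target := hy
    change ((κ 1).symm (f.map (κ 1 y)) : P.Glob) = g • y.1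
    rw [hsymm 1 _ h3, ← happ 1 y h1, PartialAction.smul_incl]
    refine (PartialAction.incl_eq_iff.2 ?_).symm
    subst hP
    exact ⟨f, hf.trans (congrArg ρ (by simp)), h2, rfl⟩

/-- The regularization theorem, for a one-dimensional geometric structure. -/
theorem isRegularizable_of_propertyFW [ClosedUnderRestriction G] (hΓ : PropertyFW Γ)
    (hι : IsOpenEmbedding ι) (hFC : FinitelyCharted G ι X) (ρ : Γ →* PC G X) :
    IsRegularizable G ι ρ := by
  rcases isEmpty_or_nonempty X with hempty | hnonempty
  · exact isRegularizable_of_isEmpty hFC ρ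
  have hreal : ∀ x : X, ∃ d : OpenPartialHomeomorph X ℝ, x ∈ d.source := by
    obtain ⟨S, -, -, hS, hS'⟩ := id hFC
    intro x
    obtain ⟨e, he, hx⟩ := mem_iUnion₂.1 (hS ▸ mem_univ x)
    obtain ⟨-, a, b, hab⟩ := hS' e he
    obtain ⟨d, hd⟩ := exists_real_chart hι e (hab.trans (image_subset_range _ _))
    exact ⟨d, hd ▸ hx⟩
  have hX : ∀ x : X, (𝓝[≠] x).NeBot := fun x => by
    obtain ⟨d, hd⟩ := hreal x
    exact neBot_nhdsNE_of_chart d hd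
  have hopen := PartialAction.isOpen_ofPC (hX := hX) (ρ := ρ)
  obtain ⟨Y, hYo, hY, hYT2, hcof, hfin⟩ :=
    PartialAction.exists_invariant_t2 hΓ hreal hopen PartialAction.exists_ofPC
  -- A cofinite subset meets every punctured neighborhood, and these are nonempty.
  have hne : Y.Nonempty := by
    obtain ⟨x⟩ := hnonempty
    have := hX x
    obtain ⟨x', hx'⟩ := (nhdsNE_le_cofinite x hcof.compl_mem_cofinite :
      _ ∈ 𝓝[≠] x) |> Filter.nonempty_of_mem
    rw [compl_compl] at hx'
    exact ⟨_, hx'⟩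
  choose κ htgt hsrc happ using PartialAction.exists_openPartialHomeomorph hopen hYo hne
  exact isRegularizable_of_partialHomeomorph hι hFC rfl hY hcof hfin κ htgt hsrc happ

end Regularization

/-! ### The affine and projective cases -/

theorem theorem3p1 (Γ : Type u) [Group Γ] (hΓ : PropertyFW Γ) :
    (∀ (X : Type u) [TopologicalSpace X] [T2Space X] [ChartedSpace ℝ X] [HasGroupoid X Aff],
      FinitelyCharted Aff (fun t : ℝ => t) X → ∀ ρ : Γ →* PC Aff X,
        ∃ (Y : Type u) (_ : TopologicalSpace Y) (_ : ChartedSpace ℝ Y) (_ : HasGroupoid Y Aff),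
          T2Space Y ∧ FinitelyCharted Aff (fun t : ℝ => t) Y ∧
          ∃ (φ : PCTrans Aff X Y) (β : Γ →* Structomorph Aff Y Y),
            ∀ g : Γ, φ.conj (ρ g) = autToPC (β g)) ∧
    (∀ (X : Type u) [TopologicalSpace X] [T2Space X] [ChartedSpace (OnePoint ℝ) X]
        [HasGroupoid X Proj],
      FinitelyCharted Proj (fun t : ℝ => (t : OnePoint ℝ)) X → ∀ ρ : Γ →* PC Proj X,
        ∃ (Y : Type u) (_ : TopologicalSpace Y) (_ : ChartedSpace (OnePoint ℝ) Y)
          (_ : HasGroupoid Y Proj),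
          T2Space Y ∧ FinitelyCharted Proj (fun t : ℝ => (t : OnePoint ℝ)) Y ∧
          ∃ (φ : PCTrans Proj X Y) (β : Γ →* Structomorph Proj Y Y),
            ∀ g : Γ, φ.conj (ρ g) = autToPC (β g)) := by
  exact ⟨fun X _ _ _ _ hX ρ => isRegularizable_of_propertyFW hΓ IsOpenEmbedding.id hX ρ,
    fun X _ _ _ _ hX ρ => isRegularizable_of_propertyFW hΓ OnePoint.isOpenEmbedding_coe hX ρ⟩
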